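/- The Farey graph $\mathcal F$ (the curve graph of the torus) has the extended rationals $\mathbb{Q}\cup\{\infty=\tfrac10\}$ as vertices, and two vertices $\tfrac pq,\tfrac rs$, written in lowest terms, are joined by an edge if and only if $|ps-qr|=1$; every edge has length $1$. The group $SL(2,\mathbb{Z})$ acts on $\mathcal F$ by M\"obius transformations. An element $f\in SL(2,\mathbb{Z})$ is called Anosov if $|\operatorname{tr} f|>2$, that is, if its class in $PSL(2,\mathbb{Z})$ is hyperbolic. We say that $l\in\mathbb{Z}_{\ge0}$ is the translation length of $f$ on $\mathcal F$ if $f$ acts on some bi-infinite geodesic of $\mathcal F$ as a translation by $l$ and $$\liminf_{j\to\infty}\frac{d_{\mathcal F}(x,f^j(x))}{j}=l\qquad\text{for every vertex } x.$$ There is at most one such $l$. For positive integers $a_1,\dots,a_n$ let $$\mathcal M(a_1,\dots,a_n)=\begin{pmatrix}p&r\\q&s\end{pmatrix},\qquad \frac pq=[a_1;a_2,\dots,a_n],\quad \frac rs=[a_1;a_2,\dots,a_{n-1}]$$ (continued fractions, written in lowest terms with positive denominators) if $n>1$, and $\mathcal M(a_1)=\begin{pmatrix}a_1&1\\1&0\end{pmatrix}$;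 in particular $\mathcal M(2)=\begin{pmatrix}2&1\\1&0\end{pmatrix}$. (1) Every Anosov $f\in SL(2,\mathbb{Z})$ has a translation length $l$ on $\mathcal F$, and $$|\operatorname{tr} f|\ \ge\ \operatorname{tr}\bigl(\mathcal M(2)^l\bigr).$$ (2) For every $n\ge1$ and all positive integers $a_1,\dots,a_{2n}$, the matrix $\mathcal M(a_1,\dots,a_{2n})$ lies in $SL(2,\mathbb{Z})$ and has a translation length $l$ on $\mathcal F$, and $$\operatorname{tr}\mathcal M(a_1,\dots,a_{2n})\ \ge\ \operatorname{tr}\bigl(\mathcal M(2)^l\bigr).$$ -/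

import Mathlib

/-- Numerator of an extended rational number `p / q` in lowest terms; the point `∞` is `1 / 0`. -/
def extNum : OnePoint ℚ → ℤ
  | none => 1
  | some x => x.num

/-- Denominator of an extended rational number `p / q` in lowest terms; the point `∞` is `1 / 0`. -/
def extDen : OnePoint ℚ → ℤ
  | none => 0
  | some x => x.den

/-- The Farey graph: the vertices are the extended rational numbers, and `p / q`, `r / s` are
joined by an edge if and only if `|p s - q r| = 1`. -/
def fareyGraph : SimpleGraph (OnePoint ℚ) where
  Adj x y := |extNum x * extDen y - extDen x * extNum y| = 1
  symm := ⟨fun x y h => by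
    rw [abs_sub_comm, mul_comm (extNum y), mul_comm (extDen y), h]⟩
  loopless := ⟨fun x h => by
    rw [mul_comm, sub_self, abs_zero] at h
    exact zero_ne_one h⟩

/-- The action of `SL(2, ℤ)` on the extended rational numbers by Möbius transformations
`x ↦ (a x + b) / (c x + d)`. -/
noncomputable def moebius (A : Matrix.SpecialLinearGroup (Fin 2) ℤ) (x : OnePoint ℚ) :
    OnePoint ℚ :=
  Matrix.SpecialLinearGroup.mapGL ℚ A • x

/-- Anosov elements of `SL(2, ℤ)` (equivalently, elements whose class in `PSL(2, ℤ)` is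
hyperbolic): the absolute value of the trace is larger than `2`. -/
def IsAnosov (A : Matrix.SpecialLinearGroup (Fin 2) ℤ) : Prop :=
  2 < |(A : Matrix (Fin 2) (Fin 2) ℤ).trace|

/-- A bi-infinite geodesic in the Farey graph, for the path metric with edges of length one. -/
def IsBiinfiniteGeodesic (P : ℤ → OnePoint ℚ) : Prop :=
  ∀ i j : ℤ, (fareyGraph.dist (P i) (P j) : ℤ) = |i - j|

/-- `A` acts on the bi-infinite geodesic `P` of the Farey graph as the translation by `l`. -/
def IsGeodesicAxis (A : Matrix.SpecialLinearGroup (Fin 2) ℤ) (P : ℤ → OnePoint ℚ) (l : ℕ) :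
    Prop :=
  IsBiinfiniteGeodesic P ∧ ∀ i : ℤ, moebius A (P i) = P (i + l)

/-- The stable translation length `liminf_j d(x, A ^ j x) / j` on the Farey graph, computed at
the vertex `x`. -/
noncomputable def stableTranslationLength (A : Matrix.SpecialLinearGroup (Fin 2) ℤ)
    (x : OnePoint ℚ) : ℝ :=
  Filter.liminf (fun j : ℕ => (fareyGraph.dist x (moebius (A ^ j) x) : ℝ) / (j : ℝ)) Filter.atTop

/-- `l` is the translation length of `A` on the Farey graph: `A` translates some bi-infinite
geodesic by `l`, and `l` is the stable translation length of `A` (at every vertex). The second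
clause determines `l` uniquely. -/
def HasTranslationLength (A : Matrix.SpecialLinearGroup (Fin 2) ℤ) (l : ℕ) : Prop :=
  (∃ P : ℤ → OnePoint ℚ, IsGeodesicAxis A P l) ∧
    ∀ x : OnePoint ℚ, stableTranslationLength A x = (l : ℝ)

/-- The value of the finite continued fraction `[a₁; a₂, …, aₙ]`. -/
def contFracValue : List ℕ → ℚ
  | [] => 0
  | [a] => a
  | a :: b :: t => a + 1 / contFracValue (b :: t)

/-- The matrix `M(a₁, …, aₙ)` with columns `(p, q)` and `(r, s)`, where, in lowest terms,
`p / q = [a₁; a₂, …, aₙ]` and `r / s = [a₁; a₂, …, aₙ₋₁]` for `n > 1`, and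
`M(a₁)` has columns `(a₁, 1)` and `(1, 0)`. (The empty sequence gets the identity matrix.) -/
def contFracMatrix : List ℕ → Matrix (Fin 2) (Fin 2) ℤ
  | [] => 1
  | [a] => !![(a : ℤ), 1; 1, 0]
  | a :: b :: t =>
      !![(contFracValue (a :: b :: t)).num, (contFracValue (a :: b :: t).dropLast).num;
        ((contFracValue (a :: b :: t)).den : ℤ), ((contFracValue (a :: b :: t).dropLast).den : ℤ)]

/-! ### Integer coordinates on the extended rationals and the Möbius action. -/

section Coordinates

open Matrix

/-! Up to sign and conjugation in `SL(2, ℤ)`, an Anosov matrix has only positive entries, so it is a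
word in the elementary matrices `U` and `L`. After a cyclic rotation the word can be cut into `l`
blocks `U ^ (m + 1) * L` or `L ^ (m + 1) * U`; each block is a fan of triangles in the Farey
tessellation.

A product of `l` fans translates a geodesic by `l`. Consecutive fan centres are adjacent, which
bounds distances from above. For the lower bound, the images of the edge `0`–`∞` under the partial
products are rungs that no Farey edge crosses; a block has positive entries, so consecutive rungs
are disjoint, and each step of a path can pass at most one of them (`le_length_of_walk`). An axis
determines the stable translation length, as the action is isometric.

For the trace, every fan multiplies a common lower bound of the forms `x + √2 * y` and `√2 * x + y`
on nonnegative row vectors by at least `1 + √2` (`pow_mul_le_prod_fans`). Applied to a positive left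
eigenvector, this gives leading eigenvalue at least `(1 + √2) ^ l`, and `t + t⁻¹` is increasing for
`t ≥ 1`. Even-length continued fraction matrices have determinant `1` and trace above `2`, so they
fall under the same argument. -/

@[simp] theorem extNum_infty : extNum (OnePoint.infty : OnePoint ℚ) = 1 := rfl
@[simp] theorem extDen_infty : extDen (OnePoint.infty : OnePoint ℚ) = 0 := rfl
@[simp] theorem extNum_coe (x : ℚ) : extNum (x : OnePoint ℚ) = x.num := rfl
@[simp] theorem extDen_coe (x : ℚ) : extDen (x : OnePoint ℚ) = x.den := rfl

theorem isCoprime_extNum_extDen (x : OnePoint ℚ) : IsCoprime (extNum x) (extDen x) := by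
  induction x using OnePoint.rec with
  | infty => exact isCoprime_one_left
  | coe x => simpa using Rat.isCoprime_num_den x

/-- The fraction `r / s`, with value `∞` if the denominator vanishes. -/
noncomputable def fracPoint (r s : ℤ) : OnePoint ℚ :=
  if (s : ℚ) = 0 then OnePoint.infty else (((r : ℚ) / s : ℚ) : OnePoint ℚ)

/-- Coprime coordinates are unique only up to a common sign; `ε` carries it, and it drops out of
adjacency and of `sideSign`. -/
theorem ext_fracPoint {r s : ℤ} (h : IsCoprime r s) :
    ∃ ε : ℤ, (ε = 1 ∨ ε = -1) ∧ extNum (fracPoint r s) = ε * r ∧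
      extDen (fracPoint r s) = ε * s := by
  rcases lt_trichotomy s 0 with hs | rfl | hs
  · refine ⟨-1, Or.inr rfl, ?_⟩
    have hs' : (s : ℚ) ≠ 0 := by exact_mod_cast hs.ne
    have e : ((r : ℚ) / s) = ((-r : ℤ) : ℚ) / ((-s : ℤ) : ℚ) := by
      push_cast; rw [neg_div_neg_eq]
    have hc : (-r).natAbs.Coprime (-s).natAbs := by
      simpa [Int.isCoprime_iff_gcd_eq_one, Int.gcd] using h
    rw [fracPoint, if_neg hs', extNum_coe, extDen_coe, e,
      Rat.num_div_eq_of_coprime (by omega) hc, Rat.den_div_eq_of_coprime (by omega) hc]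
    simp
  · have : IsUnit r := isCoprime_zero_right.1 h
    rcases Int.isUnit_iff.1 this with rfl | rfl
    · exact ⟨1, Or.inl rfl, by simp [fracPoint]⟩
    · exact ⟨-1, Or.inr rfl, by simp [fracPoint]⟩
  · refine ⟨1, Or.inl rfl, ?_⟩
    have hs' : (s : ℚ) ≠ 0 := by exact_mod_cast hs.ne'
    have hc : r.natAbs.Coprime s.natAbs := by
      simpa [Int.isCoprime_iff_gcd_eq_one, Int.gcd] using h
    rw [fracPoint, if_neg hs', extNum_coe, extDen_coe,
      Rat.num_div_eq_of_coprime hs hc, Rat.den_div_eq_of_coprime hs hc]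
    simp

theorem moebius_eq_fracPoint (A : SpecialLinearGroup (Fin 2) ℤ) (x : OnePoint ℚ) :
    moebius A x =
      fracPoint (A 0 0 * extNum x + A 0 1 * extDen x) (A 1 0 * extNum x + A 1 1 * extDen x) := by
  induction x using OnePoint.rec with
  | infty => simp [moebius, fracPoint, OnePoint.smul_infty_eq_ite]
  | coe x =>
    have hx : (x.den : ℚ) ≠ 0 := by exact_mod_cast x.den_nz
    have e (a b : ℤ) : (a : ℚ) * x + b = (a * x.num + b * x.den) / x.den := by
      rw [eq_div_iff hx, add_mul, mul_assoc, Rat.mul_den_eq_num]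
    simp only [moebius, fracPoint, OnePoint.smul_some_eq_ite, SpecialLinearGroup.mapGL_coe_matrix,
      SpecialLinearGroup.map_apply_coe, RingHom.mapMatrix_apply, Matrix.map_apply,
      algebraMap_int_eq, eq_intCast, e, extNum_coe, extDen_coe, Int.cast_add, Int.cast_mul,
      Int.cast_natCast, div_eq_zero_iff, hx, or_false, div_div_div_cancel_right₀ hx]

theorem isCoprime_mulVec (A : SpecialLinearGroup (Fin 2) ℤ) {r s : ℤ} (h : IsCoprime r s) :
    IsCoprime (A 0 0 * r + A 0 1 * s) (A 1 0 * r + A 1 1 * s) := by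
  obtain ⟨u, v, h⟩ := h
  have hd := A.det_coe
  rw [det_fin_two] at hd
  refine ⟨u * A 1 1 - v * A 1 0, v * A 0 0 - u * A 0 1, ?_⟩
  linear_combination h + (u * r + v * s) * hd

theorem ext_moebius (A : SpecialLinearGroup (Fin 2) ℤ) (x : OnePoint ℚ) :
    ∃ ε : ℤ, (ε = 1 ∨ ε = -1) ∧
      extNum (moebius A x) = ε * (A 0 0 * extNum x + A 0 1 * extDen x) ∧
      extDen (moebius A x) = ε * (A 1 0 * extNum x + A 1 1 * extDen x) := by
  rw [moebius_eq_fracPoint]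
  exact ext_fracPoint (isCoprime_mulVec A (isCoprime_extNum_extDen x))

theorem moebius_mul (A B : SpecialLinearGroup (Fin 2) ℤ) (x : OnePoint ℚ) :
    moebius (A * B) x = moebius A (moebius B x) := by
  simp [moebius, mul_smul]

@[simp] theorem moebius_one (x : OnePoint ℚ) : moebius 1 x = x := by simp [moebius]

@[simp] theorem moebius_inv_moebius (A : SpecialLinearGroup (Fin 2) ℤ) (x : OnePoint ℚ) :
    moebius A⁻¹ (moebius A x) = x := by rw [← moebius_mul]; simp

theorem fareyGraph_adj {x y : OnePoint ℚ} :
    fareyGraph.Adj x y ↔ |extNum x * extDen y - extDen x * extNum y| = 1 := Iff.rfl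

theorem adj_moebius (A : SpecialLinearGroup (Fin 2) ℤ) {x y : OnePoint ℚ}
    (h : fareyGraph.Adj x y) : fareyGraph.Adj (moebius A x) (moebius A y) := by
  rw [fareyGraph_adj] at *
  obtain ⟨ε, hε, h1, h2⟩ := ext_moebius A x
  obtain ⟨δ, hδ, h3, h4⟩ := ext_moebius A y
  have hd := A.det_coe
  rw [det_fin_two] at hd
  have : extNum (moebius A x) * extDen (moebius A y) - extDen (moebius A x) * extNum (moebius A y)
      = ε * δ * (extNum x * extDen y - extDen x * extNum y) := by
    rw [h1, h2, h3, h4]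
    linear_combination (ε * δ * (extNum x * extDen y - extDen x * extNum y)) * hd
  rw [this, abs_mul, h]
  rcases hε with rfl | rfl <;> rcases hδ with rfl | rfl <;> simp

theorem moebius_neg (A : SpecialLinearGroup (Fin 2) ℤ) (x : OnePoint ℚ) :
    moebius (-A) x = moebius A x := by
  rw [moebius_eq_fracPoint, moebius_eq_fracPoint]
  simp only [SpecialLinearGroup.coe_neg, Matrix.neg_apply, neg_mul, ← neg_add, fracPoint,
    Int.cast_neg, neg_eq_zero, neg_div_neg_eq]

end Coordinates

/-! ### Connectedness, isometries, and translation length from an axis. -/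

section Metric

open Matrix

/-- Euclidean descent: reducing a Bézout coefficient modulo the denominator gives a neighbour of
strictly smaller denominator, until `∞` is reached. -/
theorem fareyGraph_connected : fareyGraph.Connected := by
  have key : ∀ n : ℕ, ∀ x : OnePoint ℚ, (extDen x).natAbs = n →
      fareyGraph.Reachable x OnePoint.infty := by
    intro n
    induction n using Nat.strong_induction_on with
    | _ n ih =>
      intro x hx
      rcases eq_or_ne (extDen x) 0 with h0 | h0
      · have : x = OnePoint.infty := by
          induction x using OnePoint.rec with
          | infty => rfl
          | coe x => simp at h0
        rw [this]
      · obtain ⟨u, v, huv⟩ := isCoprime_extNum_extDen x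
        set p := extNum x
        set q := extDen x
        have hdm := Int.emod_add_mul_ediv u q
        have hdet : (u % q) * p + (v + p * (u / q)) * q = 1 := by
          linear_combination huv + p * hdm
        have hc : IsCoprime (-(v + p * (u / q))) (u % q) := ⟨-q, p, by linear_combination hdet⟩
        obtain ⟨ε, hε, h1, h2⟩ := ext_fracPoint hc
        have hadj : fareyGraph.Adj x (fracPoint (-(v + p * (u / q))) (u % q)) := by
          rw [fareyGraph_adj, h1, h2]
          have : p * (ε * (u % q)) - q * (ε * -(v + p * (u / q))) = ε := by
            linear_combination ε * hdet
          rw [this]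
          rcases hε with rfl | rfl <;> simp
        refine hadj.reachable.trans (ih _ ?_ _ rfl)
        have hlt := Int.emod_lt_abs u h0
        have hnn := Int.emod_nonneg u h0
        rw [Int.abs_eq_natAbs] at hlt
        rw [h2, ← hx]
        change (ε * (u % q)).natAbs < q.natAbs
        rcases hε with rfl | rfl <;> omega
  exact { preconnected := fun x y => (key _ x rfl).trans (key _ y rfl).symm
          nonempty := ⟨OnePoint.infty⟩ }

theorem dist_moebius_le (A : SpecialLinearGroup (Fin 2) ℤ) (x y : OnePoint ℚ) :
    fareyGraph.dist (moebius A x) (moebius A y) ≤ fareyGraph.dist x y := by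
  obtain ⟨p, hp⟩ := fareyGraph_connected.exists_walk_length_eq_dist x y
  let φ : fareyGraph →g fareyGraph := ⟨moebius A, fun h => adj_moebius A h⟩
  rw [← hp, ← p.length_map φ]
  exact SimpleGraph.dist_le _

theorem dist_moebius (A : SpecialLinearGroup (Fin 2) ℤ) (x y : OnePoint ℚ) :
    fareyGraph.dist (moebius A x) (moebius A y) = fareyGraph.dist x y := by
  refine le_antisymm (dist_moebius_le A x y) ?_
  simpa using dist_moebius_le A⁻¹ (moebius A x) (moebius A y)

theorem IsGeodesicAxis.pow {A : SpecialLinearGroup (Fin 2) ℤ} {P : ℤ → OnePoint ℚ} {l : ℕ}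
    (h : IsGeodesicAxis A P l) (j : ℕ) (i : ℤ) : moebius (A ^ j) (P i) = P (i + j * l) := by
  induction j with
  | zero => simp
  | succ j ih => rw [pow_succ', moebius_mul, ih, h.2]; congr 1; push_cast; ring

/-- The orbit of any vertex stays at constant distance from the orbit of `P 0`, so the displacement
under `A ^ j` differs from `j * l` by at most `K`, which division by `j` kills. -/
theorem IsGeodesicAxis.hasTranslationLength {A : SpecialLinearGroup (Fin 2) ℤ}
    {P : ℤ → OnePoint ℚ} {l : ℕ} (h : IsGeodesicAxis A P l) : HasTranslationLength A l := by
  refine ⟨⟨P, h⟩, fun x => ?_⟩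
  set K : ℝ := 2 * fareyGraph.dist x (P 0) with hK
  have hP (j : ℕ) : fareyGraph.dist (P 0) (moebius (A ^ j) (P 0)) = j * l := by
    have := h.1 0 (0 + j * l)
    rw [h.pow]
    have h2 : |(0 : ℤ) - (0 + j * l)| = j * l := by
      rw [zero_add, zero_sub, abs_neg, abs_of_nonneg (by positivity)]
    rw [h2] at this
    exact_mod_cast this
  have hb (j : ℕ) : |(fareyGraph.dist x (moebius (A ^ j) x) : ℝ) - j * l| ≤ K := by
    have h1 := fareyGraph_connected.dist_triangle (u := x) (v := P 0) (w := moebius (A ^ j) x)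
    have h2 := fareyGraph_connected.dist_triangle (u := P 0) (v := moebius (A ^ j) (P 0))
      (w := moebius (A ^ j) x)
    have h3 := fareyGraph_connected.dist_triangle (u := P 0) (v := x) (w := moebius (A ^ j) (P 0))
    have h4 := fareyGraph_connected.dist_triangle (u := x) (v := moebius (A ^ j) x)
      (w := moebius (A ^ j) (P 0))
    have h7 := dist_moebius (A ^ j) (P 0) x
    have h8 := dist_moebius (A ^ j) x (P 0)
    have h9 := fareyGraph.dist_comm (u := P 0) (v := x)
    rw [hP] at h2 h3
    rw [abs_le, hK]
    have h5 : (fareyGraph.dist x (moebius (A ^ j) x)) ≤ j * l + 2 * fareyGraph.dist x (P 0) := by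
      omega
    have h6 : j * l ≤ fareyGraph.dist x (moebius (A ^ j) x) + 2 * fareyGraph.dist x (P 0) := by
      omega
    have h5' : (fareyGraph.dist x (moebius (A ^ j) x) : ℝ) ≤
      j * l + 2 * fareyGraph.dist x (P 0) := by exact_mod_cast h5
    have h6' : (j * l : ℝ) ≤ fareyGraph.dist x (moebius (A ^ j) x)
      + 2 * fareyGraph.dist x (P 0) := by exact_mod_cast h6
    constructor <;> linarith
  refine Filter.Tendsto.liminf_eq ?_
  rw [tendsto_iff_dist_tendsto_zero]
  refine squeeze_zero' (g := fun j : ℕ => K / j) (.of_forall fun _ => dist_nonneg) ?_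
    (tendsto_const_div_atTop_nhds_zero_nat K)
  filter_upwards [Filter.eventually_gt_atTop 0] with j hj
  have hj' : (0 : ℝ) < j := by exact_mod_cast hj
  rw [Real.dist_eq, show (fareyGraph.dist x (moebius (A ^ j) x) : ℝ) / j - l =
    (fareyGraph.dist x (moebius (A ^ j) x) - j * l) / j by field_simp, abs_div, abs_of_pos hj']
  gcongr
  exact hb j

theorem IsGeodesicAxis.conj {A : SpecialLinearGroup (Fin 2) ℤ} {P : ℤ → OnePoint ℚ} {l : ℕ}
    (h : IsGeodesicAxis A P l) (g : SpecialLinearGroup (Fin 2) ℤ) :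
    IsGeodesicAxis (g * A * g⁻¹) (fun i => moebius g (P i)) l := by
  refine ⟨fun i j => ?_, fun i => ?_⟩
  · rw [dist_moebius]; exact h.1 i j
  · rw [moebius_mul, moebius_mul, moebius_inv_moebius, h.2]

theorem IsGeodesicAxis.neg {A : SpecialLinearGroup (Fin 2) ℤ} {P : ℤ → OnePoint ℚ} {l : ℕ}
    (h : IsGeodesicAxis A P l) : IsGeodesicAxis (-A) P l :=
  ⟨h.1, fun i => by rw [moebius_neg, h.2]⟩

end Metric

/-! ### Products of fans translate geodesics. -/

section Ladder

open Matrix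

/-- The fan matrices `U ^ (m + 1) * L` and `L ^ (m + 1) * U`, where `U` and `L` are the elementary
upper and lower triangular matrices. -/
def fanMatrix : Bool × ℕ → SpecialLinearGroup (Fin 2) ℤ
  | (true, m) => ⟨!![(m : ℤ) + 2, m + 1; 1, 1], by rw [det_fin_two_of]; ring⟩
  | (false, m) => ⟨!![1, 1; (m : ℤ) + 1, m + 2], by rw [det_fin_two_of]; ring⟩

/-- The centre of a fan. -/
noncomputable def fanCenter : Bool → OnePoint ℚ
  | true => OnePoint.infty
  | false => ((0 : ℚ) : OnePoint ℚ)

/-- A sign: positive inside the interval `(0, ∞)`, zero at its endpoints, negative outside. -/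
def sideSign (x : OnePoint ℚ) : ℤ := extNum x * extDen x

@[simp] theorem sideSign_fanCenter (b : Bool) : sideSign (fanCenter b) = 0 := by
  cases b <;> simp [sideSign, fanCenter]

theorem fanMatrix_pos (β : Bool × ℕ) (i j : Fin 2) : 0 < fanMatrix β i j := by
  obtain ⟨b, m⟩ := β
  cases b <;> fin_cases i <;> fin_cases j <;> simp [fanMatrix] <;> omega

theorem adj_fanCenter (β : Bool × ℕ) (b : Bool) :
    fareyGraph.Adj (fanCenter β.1) (moebius (fanMatrix β) (fanCenter b)) := by
  obtain ⟨ε, hε, h1, h2⟩ := ext_moebius (fanMatrix β) (fanCenter b)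
  rw [fareyGraph_adj, h1, h2]
  obtain ⟨c, m⟩ := β
  rcases hε with rfl | rfl <;> cases c <;> cases b <;> simp [fanCenter, fanMatrix]

theorem sideSign_moebius_pos {g : SpecialLinearGroup (Fin 2) ℤ} (hg : ∀ i j, 0 < g i j)
    {x : OnePoint ℚ} (hx : 0 ≤ sideSign x) : 0 < sideSign (moebius g x) := by
  obtain ⟨ε, hε, h1, h2⟩ := ext_moebius g x
  have hc := isCoprime_extNum_extDen x
  rw [sideSign] at *
  set p := extNum x
  set q := extDen x
  have e : ε * ε = 1 := by rcases hε with rfl | rfl <;> rfl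
  rw [h1, h2, show ε * (g 0 0 * p + g 0 1 * q) * (ε * (g 1 0 * p + g 1 1 * q)) =
    ε * ε * (g 0 0 * g 1 0 * (p * p) + g 0 1 * g 1 1 * (q * q) +
      (g 0 0 * g 1 1 + g 0 1 * g 1 0) * (p * q)) by ring, e, one_mul]
  have h00 := hg 0 0
  have h01 := hg 0 1
  have h10 := hg 1 0
  have h11 := hg 1 1
  have hpq : p ≠ 0 ∨ q ≠ 0 := by
    by_contra! h
    rw [h.1, h.2] at hc
    exact not_isCoprime_zero_zero hc
  have h3 : 0 ≤ (g 0 0 * g 1 1 + g 0 1 * g 1 0) * (p * q) := by positivity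
  rcases hpq with h | h
  · have : 0 < g 0 0 * g 1 0 * (p * p) := by have := mul_self_pos.2 h; positivity
    have : 0 ≤ g 0 1 * g 1 1 * (q * q) := by have := mul_self_nonneg q; positivity
    linarith
  · have : 0 ≤ g 0 0 * g 1 0 * (p * p) := by have := mul_self_nonneg p; positivity
    have : 0 < g 0 1 * g 1 1 * (q * q) := by have := mul_self_pos.2 h; positivity
    linarith

/-- No Farey edge crosses the edge `0`–`∞`: for endpoints strictly on opposite sides, `p * s` and `q
* r` are nonzero of opposite signs, so their difference has absolute value at least `2`. -/
theorem sideSign_nonneg_of_adj {x y : OnePoint ℚ} (h : fareyGraph.Adj x y)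
    (hy : 0 < sideSign y) : 0 ≤ sideSign x := by
  rw [fareyGraph_adj] at h
  rw [sideSign] at *
  set p := extNum x
  set q := extDen x
  set r := extNum y
  set s := extDen y
  by_contra! hx
  have h1 : (p * s) * (q * r) < 0 := by
    rw [show p * s * (q * r) = (p * q) * (r * s) by ring]
    exact mul_neg_of_neg_of_pos hx hy
  have h2 : (p * s - q * r) ^ 2 = 1 := by rw [← sq_abs, h]; norm_num
  rcases mul_neg_iff.1 h1 with ⟨h3, h4⟩ | ⟨h3, h4⟩ <;> nlinarith

variable {g : ℤ → SpecialLinearGroup (Fin 2) ℤ} {β : ℤ → Bool × ℕ}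

/-- The edge `g n (0, ∞)` is the `n`-th rung. The walk starts not beyond rung `n` and ends not
before rung `n + k`. Its first edge cannot land strictly beyond rung `n + 1`: its start would then
lie on or beyond rung `n + 1`, hence strictly beyond rung `n`. -/
theorem le_length_of_walk (hg : ∀ n, g (n + 1) = g n * fanMatrix (β n)) {x y : OnePoint ℚ}
    (w : fareyGraph.Walk y x) : ∀ (k : ℕ) (n : ℤ), 0 ≤ sideSign (moebius (g (n + k))⁻¹ x) →
      sideSign (moebius (g n)⁻¹ y) ≤ 0 → k ≤ w.length := by
  have step (n : ℤ) (z : OnePoint ℚ) (hz : 0 ≤ sideSign (moebius (g (n + 1))⁻¹ z)) :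
      0 < sideSign (moebius (g n)⁻¹ z) := by
    have := sideSign_moebius_pos (fanMatrix_pos (β n)) hz
    rwa [← moebius_mul, hg, _root_.mul_inv_rev, mul_inv_cancel_left] at this
  have steps (k : ℕ) : ∀ (n : ℤ) (z : OnePoint ℚ),
      0 ≤ sideSign (moebius (g (n + k))⁻¹ z) → 0 ≤ sideSign (moebius (g n)⁻¹ z) := by
    induction k with
    | zero => intro n z hz; simpa using hz
    | succ k ih =>
      intro n z hz
      refine (step n z (ih _ z ?_)).le
      rwa [add_assoc, add_comm (1 : ℤ), ← Nat.cast_succ]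
  induction w with
  | nil =>
    intro k n hx hy
    by_contra! hk
    obtain ⟨k, rfl⟩ : ∃ j, k = j + 1 := ⟨k - 1, by simp at hk; omega⟩
    refine absurd (step n _ (steps k _ _ ?_)) (not_lt.2 hy)
    rwa [add_assoc, add_comm (1 : ℤ), ← Nat.cast_succ]
  | @cons y y' x hadj w ih =>
    intro k n hx hy
    rcases k with _ | k
    · exact Nat.zero_le _
    · rw [SimpleGraph.Walk.length_cons]
      refine Nat.succ_le_succ (ih k (n + 1) ?_ ?_)
      · rwa [add_assoc, add_comm (1 : ℤ), ← Nat.cast_succ]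
      · by_contra! hc
        have := sideSign_nonneg_of_adj (adj_moebius (g (n + 1))⁻¹ hadj) hc
        exact absurd (step n y this) (not_lt.2 hy)

theorem isBiinfiniteGeodesic_of_fans (hg : ∀ n, g (n + 1) = g n * fanMatrix (β n)) :
    IsBiinfiniteGeodesic fun n => moebius (g n) (fanCenter (β n).1) := by
  set P : ℤ → OnePoint ℚ := fun n => moebius (g n) (fanCenter (β n).1) with hP
  have hadj (n : ℤ) : fareyGraph.Adj (P n) (P (n + 1)) := by
    simp only [hP]
    rw [hg, moebius_mul]
    exact adj_moebius _ (adj_fanCenter _ _)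
  have hside (n : ℤ) : sideSign (moebius (g n)⁻¹ (P n)) = 0 := by simp [hP]
  have hle (n : ℤ) (k : ℕ) : fareyGraph.dist (P n) (P (n + k)) ≤ k := by
    induction k with
    | zero => simp
    | succ k ih =>
      have h1 := fareyGraph_connected.dist_triangle (u := P n) (v := P (n + k))
        (w := P (n + k + 1))
      have h2 := SimpleGraph.dist_eq_one_iff_adj.2 (hadj (n + k))
      rw [Nat.cast_succ, ← add_assoc]
      omega
  have heq (n : ℤ) (k : ℕ) : fareyGraph.dist (P n) (P (n + k)) = k := by
    refine le_antisymm (hle n k) ?_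
    obtain ⟨w, hw⟩ := fareyGraph_connected.exists_walk_length_eq_dist (P n) (P (n + k))
    rw [← hw]
    exact le_length_of_walk hg w k n (hside _).ge (hside _).le
  intro i j
  rcases le_total i j with h | h
  · obtain ⟨k, rfl⟩ := Int.le.dest h
    rw [heq]; simp
  · obtain ⟨k, rfl⟩ := Int.le.dest h
    rw [SimpleGraph.dist_comm, heq]; simp

/-- The list is repeated periodically in both directions: with `n = c * k + i`, `g n` is `A ^ k`
times the product of the first `i` fans, so a shift by `c` is left multiplication by `A`. -/
theorem exists_isGeodesicAxis_prod_fans (B : List (Bool × ℕ)) (hB : B ≠ []) :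
    ∃ P, IsGeodesicAxis (B.map fanMatrix).prod P B.length := by
  set A := (B.map fanMatrix).prod with hA
  set c := B.length with hc
  have hc0 : 0 < c := List.length_pos_iff.2 hB
  have hc0' : (0 : ℤ) < c := by exact_mod_cast hc0
  have hlt (n : ℤ) : (n % c).toNat < c := by
    have := Int.emod_lt_of_pos n hc0'
    have := Int.emod_nonneg n hc0'.ne'
    omega
  let β : ℤ → Bool × ℕ := fun n => B[(n % c).toNat]'(hlt n)
  let g : ℤ → SpecialLinearGroup (Fin 2) ℤ := fun n =>
    A ^ (n / c) * ((B.take (n % c).toNat).map fanMatrix).prod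
  have hg (n : ℤ) : g (n + 1) = g n * fanMatrix (β n) := by
    have key : ((B.take (n % c).toNat).map fanMatrix).prod * fanMatrix (β n) =
        ((B.take ((n % c).toNat + 1)).map fanMatrix).prod := by
      rw [List.take_succ_eq_append_getElem (hlt n)]
      simp only [β, List.map_append, List.prod_append, List.map_singleton, List.prod_singleton]
    simp only [g]
    rw [mul_assoc, key]
    have h1 := Int.emod_add_mul_ediv n c
    have h2 := Int.emod_nonneg n hc0'.ne'
    have h3 := Int.emod_lt_of_pos n hc0'
    -- At the end of a period the prefix is the whole list, and its product becomes one more factor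
    -- `A`.
    rcases eq_or_ne (n % c + 1) c with h | h
    · have e : n + 1 = c * (n / c + 1) := by linear_combination -h1 + h
      have e2 : (n % c).toNat + 1 = c := by omega
      rw [e, Int.mul_ediv_cancel_left _ hc0'.ne', Int.mul_emod_right, e2, hc, List.take_length,
        ← hA, _root_.zpow_add_one]
      simp
    · have e : n + 1 = (n % c + 1) + c * (n / c) := by linear_combination -h1
      have h4 : n % c + 1 < c := by omega
      have e2 : (n + 1) / c = n / c := by
        conv_lhs => rw [e]
        rw [Int.add_mul_ediv_left _ _ hc0'.ne', Int.ediv_eq_zero_of_lt (by omega) h4, zero_add]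
      have e3 : (n + 1) % c = n % c + 1 := by
        conv_lhs => rw [e]
        rw [Int.add_mul_emod_self_left, Int.emod_eq_of_lt (by omega) h4]
      rw [e2, e3, Int.toNat_add h2 (by norm_num)]
      simp
  refine ⟨_, isBiinfiniteGeodesic_of_fans hg, fun n => ?_⟩
  have e1 : β (n + c) = β n := by simp [β]
  have e2 : g (n + c) = A * g n := by
    simp only [g]
    rw [Int.add_emod_right, Int.add_ediv_of_dvd_right (dvd_refl _), Int.ediv_self hc0'.ne',
      add_comm, _root_.zpow_one_add, mul_assoc]
  simp only [e1, e2, moebius_mul]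

end Ladder

/-! ### Conjugating a matrix of trace above two into a product of fans. -/

section Reduction

open Matrix

/-- The elementary upper (`true`) and lower (`false`) triangular matrices. -/
def elemMatrix : Bool → SpecialLinearGroup (Fin 2) ℤ
  | true => ⟨!![1, 1; 0, 1], by simp⟩
  | false => ⟨!![1, 0; 1, 1], by simp⟩

theorem coe_elemMatrix_pow (b : Bool) (k : ℕ) :
    ((elemMatrix b ^ k : SpecialLinearGroup (Fin 2) ℤ) : Matrix (Fin 2) (Fin 2) ℤ) =
      bif b then !![1, (k : ℤ); 0, 1] else !![1, 0; (k : ℤ), 1] := by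
  induction k with
  | zero => cases b <;> simp [one_fin_two]
  | succ k ih =>
    rw [pow_succ, Matrix.SpecialLinearGroup.coe_mul, ih]
    cases b <;> simp [elemMatrix, add_comm]

theorem elemMatrix_pow_mul (b : Bool) (m : ℕ) :
    elemMatrix b ^ (m + 1) * elemMatrix (!b) = fanMatrix (b, m) := by
  apply Subtype.ext
  change ((elemMatrix b ^ (m + 1) * elemMatrix (!b) : SpecialLinearGroup (Fin 2) ℤ) :
      Matrix (Fin 2) (Fin 2) ℤ) = _
  rw [Matrix.SpecialLinearGroup.coe_mul, coe_elemMatrix_pow]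
  cases b <;> simp [elemMatrix, fanMatrix] <;> ring

/-- The product of the elementary matrices spelled by a word. -/
def wordMatrix (w : List Bool) : SpecialLinearGroup (Fin 2) ℤ := (w.map elemMatrix).prod

theorem wordMatrix_append (v w : List Bool) :
    wordMatrix (v ++ w) = wordMatrix v * wordMatrix w := by simp [wordMatrix]

theorem wordMatrix_replicate (b : Bool) (k : ℕ) :
    wordMatrix (List.replicate k b) = elemMatrix b ^ k := by simp [wordMatrix]

/-- With determinant `1` and nonnegative entries, either one column dominates the other and can be
reduced by subtraction, lowering the sum of the entries, or the matrix is the identity. -/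
theorem exists_wordMatrix_eq (A : SpecialLinearGroup (Fin 2) ℤ) (hA : ∀ i j, 0 ≤ A i j) :
    ∃ w, A = wordMatrix w := by
  induction h : (A 0 0 + A 0 1 + A 1 0 + A 1 1).toNat using Nat.strong_induction_on generalizing A
    with
  | _ n ih =>
  have hd := A.det_coe
  rw [det_fin_two] at hd
  have h00 := hA 0 0
  have h01 := hA 0 1
  have h10 := hA 1 0
  have h11 := hA 1 1
  by_cases hU : A 0 0 ≤ A 0 1 ∧ A 1 0 ≤ A 1 1
  · let A' : SpecialLinearGroup (Fin 2) ℤ :=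
      ⟨!![A 0 0, A 0 1 - A 0 0; A 1 0, A 1 1 - A 1 0], by
        rw [det_fin_two_of]; linear_combination hd⟩
    have e : A = A' * elemMatrix true := by
      ext i j
      rw [Matrix.SpecialLinearGroup.coe_mul, mul_apply, Fin.sum_univ_two]
      fin_cases i <;> fin_cases j <;> simp [A', elemMatrix]
    have hpos : 0 < A 0 0 + A 1 0 := by
      by_contra! hc
      rw [show A 0 0 = 0 by omega, show A 1 0 = 0 by omega] at hd
      simp at hd
    obtain ⟨w, hw⟩ := ih _ (by simp [A']; omega) A'
      (by intro i j; fin_cases i <;> fin_cases j <;> simp [A'] <;> omega) rfl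
    exact ⟨w ++ [true], by rw [e, hw, wordMatrix_append]; simp [wordMatrix]⟩
  by_cases hL : A 0 1 ≤ A 0 0 ∧ A 1 1 ≤ A 1 0
  · let A' : SpecialLinearGroup (Fin 2) ℤ :=
      ⟨!![A 0 0 - A 0 1, A 0 1; A 1 0 - A 1 1, A 1 1], by
        rw [det_fin_two_of]; linear_combination hd⟩
    have e : A = A' * elemMatrix false := by
      ext i j
      rw [Matrix.SpecialLinearGroup.coe_mul, mul_apply, Fin.sum_univ_two]
      fin_cases i <;> fin_cases j <;> simp [A', elemMatrix]
    have hpos : 0 < A 0 1 + A 1 1 := by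
      by_contra! hc
      rw [show A 0 1 = 0 by omega, show A 1 1 = 0 by omega] at hd
      simp at hd
    obtain ⟨w, hw⟩ := ih _ (by simp [A']; omega) A'
      (by intro i j; fin_cases i <;> fin_cases j <;> simp [A'] <;> omega) rfl
    exact ⟨w ++ [false], by rw [e, hw, wordMatrix_append]; simp [wordMatrix]⟩
  have h1 : A 0 1 < A 0 0 ∧ A 1 0 < A 1 1 := by
    by_contra! hc
    have h2 : A 0 0 < A 0 1 ∧ A 1 1 < A 1 0 := by
      by_cases h3 : A 0 1 < A 0 0
      · have := hc h3; omega
      · omega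
    nlinarith
  have h2 : A 0 1 = 0 ∧ A 1 0 = 0 := by constructor <;> nlinarith
  have h3 : A 0 0 = 1 ∧ A 1 1 = 1 := by
    rw [h2.1, zero_mul, sub_zero] at hd
    have := Int.eq_one_or_neg_one_of_mul_eq_one hd
    have := Int.eq_one_or_neg_one_of_mul_eq_one' hd
    omega
  refine ⟨[], ?_⟩
  ext i j
  fin_cases i <;> fin_cases j <;> simp [wordMatrix, h2, h3]

/-- The difference between the distances of the two ends of a rung of the ladder to a point far to
the left of it, after one more triangle has been added. -/
def rungStep (d : ℤ) (b : Bool) : ℤ := if b then min (d + 1) 1 else max (d - 1) (-1)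

theorem foldl_rungStep_mono (w : List Bool) {d e : ℤ} (h : d ≤ e) :
    w.foldl rungStep d ≤ w.foldl rungStep e := by
  induction w generalizing d e with
  | nil => exact h
  | cons b w ih =>
    refine ih ?_
    clear ih
    cases b <;> simp only [rungStep] <;> grind

theorem foldl_rungStep_mem (w : List Bool) {d : ℤ} (h : -1 ≤ d ∧ d ≤ 1) :
    -1 ≤ w.foldl rungStep d ∧ w.foldl rungStep d ≤ 1 := by
  induction w generalizing d with
  | nil => exact h
  | cons b w ih =>
    refine ih ?_
    clear ih
    cases b <;> simp only [rungStep] <;> grind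

/-- A monotone self-map of `{-1, 0, 1}` has a fixed point. It will serve as the state of the
periodic bi-infinite word. -/
theorem exists_foldl_rungStep_eq (w : List Bool) :
    ∃ d, (-1 ≤ d ∧ d ≤ 1) ∧ w.foldl rungStep d = d := by
  have h0 := foldl_rungStep_mem w (d := 0) (by norm_num)
  have h1 := foldl_rungStep_mem w (d := 1) (by norm_num)
  have h2 := foldl_rungStep_mem w (d := -1) (by norm_num)
  have m1 := foldl_rungStep_mono w (d := 0) (e := 1) (by norm_num)
  have m2 := foldl_rungStep_mono w (d := -1) (e := 0) (by norm_num)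
  rcases lt_trichotomy (w.foldl rungStep 0) 0 with h | h | h
  · exact ⟨-1, by norm_num, by omega⟩
  · exact ⟨0, by norm_num, h⟩
  · exact ⟨1, by norm_num, by omega⟩

/-- From `-1` the state stays put until the first `true`, which moves it to `0`; symmetrically from
`1`. State `0` marks a place where the word may be cut into blocks. -/
theorem exists_split_of_mem (w : List Bool) {d : ℤ} (hd : -1 ≤ d ∧ d ≤ 1) (ht : true ∈ w)
    (hf : false ∈ w) : ∃ u v, w = u ++ v ∧ u.foldl rungStep d = 0 := by
  have key (b : Bool) (w : List Bool) (hb : b ∈ w) :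
      ∃ u v, w = u ++ v ∧ u.foldl rungStep (if b then -1 else 1) = 0 := by
    induction w with
    | nil => simp at hb
    | cons c w ih =>
      by_cases hc : c = b
      · subst hc
        exact ⟨[c], w, rfl, by cases c <;> simp [rungStep]⟩
      · obtain ⟨u, v, rfl, hu⟩ := ih (by simpa [Ne.symm hc] using hb)
        refine ⟨c :: u, v, rfl, ?_⟩
        have : rungStep (if b then -1 else 1) c = if b then -1 else 1 := by
          cases b <;> cases c <;> simp [rungStep] at hc ⊢
        rw [List.foldl_cons, this, hu]
  obtain rfl | rfl | rfl : d = -1 ∨ d = 0 ∨ d = 1 := by omega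
  · simpa using key true w ht
  · exact ⟨[], w, rfl, rfl⟩
  · simpa using key false w hf

/-- Greedy parsing: state `0` means that a block has just closed, state `1` or `-1` that a run of
`true` or `false` is open and closes at the next opposite letter. The second clause carries the open
run so that the induction goes through. -/
theorem exists_fans_of_foldl (w : List Bool) :
    (w.foldl rungStep 0 = 0 → ∃ B : List (Bool × ℕ), wordMatrix w = (B.map fanMatrix).prod) ∧
    ∀ (b : Bool) (m : ℕ), w.foldl rungStep (if b then 1 else -1) = 0 →
      ∃ B : List (Bool × ℕ), wordMatrix (List.replicate (m + 1) b ++ w) =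
        (B.map fanMatrix).prod := by
  induction w with
  | nil => exact ⟨fun _ => ⟨[], rfl⟩, fun b m h => by cases b <;> simp at h⟩
  | cons c w ih =>
    constructor
    · intro h
      refine ih.2 c 0 ?_
      rw [← h, List.foldl_cons]
      cases c <;> simp [rungStep]
    · intro b m h
      rw [List.foldl_cons] at h
      by_cases hc : c = b
      · subst hc
        obtain ⟨B, hB⟩ := ih.2 c (m + 1) (by rw [← h]; cases c <;> simp [rungStep])
        refine ⟨B, ?_⟩
        rw [← hB, List.replicate_succ' (n := m + 1)]
        simp
      · obtain rfl : c = !b := by cases b <;> cases c <;> simp at hc ⊢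
        obtain ⟨B, hB⟩ := ih.1 (by
          rwa [show rungStep (if b then 1 else -1) (!b) = 0 by cases b <;> simp [rungStep]] at h)
        refine ⟨(b, m) :: B, ?_⟩
        rw [← List.singleton_append, wordMatrix_append, wordMatrix_append, wordMatrix_replicate,
          hB, ← mul_assoc, List.map_cons, List.prod_cons, ← elemMatrix_pow_mul]
        simp [wordMatrix]

theorem mem_of_forall_pos {w : List Bool} (hw : ∀ i j, 0 < wordMatrix w i j) (b : Bool) :
    b ∈ w := by
  by_contra hb
  have h : w = List.replicate w.length (!b) :=
    List.eq_replicate_iff.2 ⟨rfl, fun c hc => by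
      cases b <;> cases c <;> simp_all⟩
  have := hw (bif !b then 1 else 0) (bif !b then 0 else 1)
  rw [h, wordMatrix_replicate, coe_elemMatrix_pow] at this
  cases b <;> simp at this

theorem exists_conj_fans_of_pos (A : SpecialLinearGroup (Fin 2) ℤ) (hA : ∀ i j, 0 < A i j) :
    ∃ (g : SpecialLinearGroup (Fin 2) ℤ) (B : List (Bool × ℕ)),
      A = g * (B.map fanMatrix).prod * g⁻¹ := by
  obtain ⟨w, rfl⟩ := exists_wordMatrix_eq A fun i j => (hA i j).le
  obtain ⟨d, hd, hwd⟩ := exists_foldl_rungStep_eq w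
  obtain ⟨u, v, rfl, hu⟩ := exists_split_of_mem w hd (mem_of_forall_pos hA true)
    (mem_of_forall_pos hA false)
  rw [List.foldl_append, hu] at hwd
  -- Rotating to `v ++ u` makes the state go from `0` to `d` and back to `0`.
  obtain ⟨B, hB⟩ := (exists_fans_of_foldl (v ++ u)).1 (by rw [List.foldl_append, hwd, hu])
  exact ⟨wordMatrix u, B, by rw [← hB, wordMatrix_append, wordMatrix_append]; group⟩

theorem abs_le_of_abs_le_abs_add {x c : ℤ} (hc : c ≠ 0) (h1 : |x| ≤ |x + 2 * c|)
    (h2 : |x| ≤ |x - 2 * c|) : |x| ≤ |c| := by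
  rcases abs_cases x with h | h <;> rcases abs_cases c with h' | h' <;>
    rcases abs_cases (x + 2 * c) with h'' | h'' <;>
    rcases abs_cases (x - 2 * c) with h''' | h''' <;> omega

/-- Take a conjugate minimising the difference of the diagonal entries in absolute value. Shears
cannot improve it, which bounds this difference by each off-diagonal entry and forces those entries
to have the same sign. -/
theorem exists_conj_pos (A : SpecialLinearGroup (Fin 2) ℤ)
    (hA : 2 < (A : Matrix (Fin 2) (Fin 2) ℤ).trace) :
    ∃ g C : SpecialLinearGroup (Fin 2) ℤ, A = g * C * g⁻¹ ∧ ∀ i j, 0 < C i j := by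
  let S : Set (SpecialLinearGroup (Fin 2) ℤ) := {C | ∃ g, A = g * C * g⁻¹}
  let size : SpecialLinearGroup (Fin 2) ℤ → ℕ := fun C => (C 0 0 - C 1 1).natAbs
  have hconj {C : SpecialLinearGroup (Fin 2) ℤ} (hC : C ∈ S) (h : SpecialLinearGroup (Fin 2) ℤ) :
      h * C * h⁻¹ ∈ S := by
    obtain ⟨g, hg⟩ := hC
    exact ⟨g * h⁻¹, by rw [hg]; group⟩
  obtain ⟨C, hCS, hmin⟩ : ∃ C ∈ S, ∀ D ∈ S, size C ≤ size D := by
    obtain ⟨C, hC⟩ := WellFounded.has_min (measure size).wf S ⟨A, 1, by simp⟩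
    exact ⟨C, hC.1, fun D hD => not_lt.1 (hC.2 D hD)⟩
  have htr : C 0 0 + C 1 1 = (A : Matrix (Fin 2) (Fin 2) ℤ).trace := by
    obtain ⟨g, rfl⟩ := hCS
    rw [Matrix.SpecialLinearGroup.coe_mul, trace_mul_comm, ← Matrix.SpecialLinearGroup.coe_mul,
      ← mul_assoc,
      inv_mul_cancel, one_mul, trace_fin_two]
  have hd := C.det_coe
  rw [det_fin_two] at hd
  have up (k : ℤ) : |C 0 0 - C 1 1| ≤ |C 0 0 - C 1 1 + 2 * k * C 1 0| := by
    let h : SpecialLinearGroup (Fin 2) ℤ := ⟨!![1, k; 0, 1], by simp⟩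
    have := hmin _ (hconj hCS h)
    rw [Int.abs_eq_natAbs, Int.abs_eq_natAbs]
    have e : (h * C * h⁻¹) 0 0 - (h * C * h⁻¹) 1 1 = C 0 0 - C 1 1 + 2 * k * C 1 0 := by
      simp only [Matrix.SpecialLinearGroup.coe_mul, Matrix.SpecialLinearGroup.coe_inv, mul_apply,
        Fin.sum_univ_two, adjugate_fin_two]
      simp [h]
      ring
    simp only [size] at this
    rw [e] at this
    exact_mod_cast this
  have lo (k : ℤ) : |C 0 0 - C 1 1| ≤ |C 0 0 - C 1 1 - 2 * k * C 0 1| := by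
    let h : SpecialLinearGroup (Fin 2) ℤ := ⟨!![1, 0; k, 1], by simp⟩
    have := hmin _ (hconj hCS h)
    rw [Int.abs_eq_natAbs, Int.abs_eq_natAbs]
    have e : (h * C * h⁻¹) 0 0 - (h * C * h⁻¹) 1 1 = C 0 0 - C 1 1 - 2 * k * C 0 1 := by
      simp only [Matrix.SpecialLinearGroup.coe_mul, Matrix.SpecialLinearGroup.coe_inv, mul_apply,
        Fin.sum_univ_two, adjugate_fin_two]
      simp [h]
      ring
    simp only [size] at this
    rw [e] at this
    exact_mod_cast this
  have hpos : 0 < C 0 1 * C 1 0 := by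
    by_contra! hle
    rw [← htr] at hA
    have hne : C 0 1 * C 1 0 ≠ 0 := by
      intro h0
      rw [h0, sub_zero] at hd
      have := Int.eq_one_or_neg_one_of_mul_eq_one hd
      have := Int.eq_one_or_neg_one_of_mul_eq_one' hd
      omega
    have h5 := abs_le_of_abs_le_abs_add (right_ne_zero_of_mul hne)
      (by simpa using up 1) (by simpa [sub_eq_add_neg] using up (-1))
    have h6 := abs_le_of_abs_le_abs_add (left_ne_zero_of_mul hne)
      (by simpa using lo (-1)) (by simpa using lo 1)
    have h7 : |C 0 0 - C 1 1| * |C 0 0 - C 1 1| ≤ |C 0 1| * |C 1 0| :=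
      mul_le_mul h6 h5 (abs_nonneg _) (abs_nonneg _)
    rw [abs_mul_abs_self, ← abs_mul, abs_of_nonpos hle] at h7
    -- The discriminant `tr ^ 2 - 4 = (a - d) ^ 2 + 4 * b * c` would be at most `3 * b * c ≤ 0`.
    nlinarith
  have had : 0 < C 0 0 ∧ 0 < C 1 1 := by
    have : 0 < C 0 0 * C 1 1 := by linarith
    rcases mul_pos_iff.1 this with h | h
    · exact h
    · omega
  obtain ⟨g, hg⟩ := hCS
  rcases mul_pos_iff.1 hpos with h | h
  · exact ⟨g, C, hg, by intro i j; fin_cases i <;> fin_cases j <;> simp [*]⟩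
  -- The quarter turn swaps the off-diagonal entries and changes their signs.
  · let r : SpecialLinearGroup (Fin 2) ℤ := ⟨!![0, -1; 1, 0], by simp⟩
    refine ⟨g * r⁻¹, r * C * r⁻¹, by rw [hg]; group, ?_⟩
    intro i j
    simp only [Matrix.SpecialLinearGroup.coe_mul, Matrix.SpecialLinearGroup.coe_inv, mul_apply,
      Fin.sum_univ_two, adjugate_fin_two]
    fin_cases i <;> fin_cases j <;> simp [r, *]

end Reduction

/-! ### Growth by the silver ratio and the trace inequality. -/

section Trace

open Matrix

theorem prod_fans_pos (B : List (Bool × ℕ)) (hB : B ≠ []) (i j : Fin 2) :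
    0 < (B.map fanMatrix).prod i j := by
  induction B generalizing i with
  | nil => exact absurd rfl hB
  | cons β B ih =>
    rcases eq_or_ne B [] with rfl | h
    · simpa using fanMatrix_pos β i j
    · rw [List.map_cons, List.prod_cons, Matrix.SpecialLinearGroup.coe_mul, mul_apply]
      exact Finset.sum_pos (fun k _ => mul_pos (fanMatrix_pos β i k) (ih h k)) Finset.univ_nonempty

/-- The columns `(1, √2)` and `(√2, 1)` are exchanged, up to the factor `1 + √2`, in one direction
by `U * L` and in the other by `L * U`, so alternating these is the slowest growth. Bounding both
forms at once covers every order of the fans. -/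
theorem pow_mul_le_prod_fans (B : List (Bool × ℕ)) {K x y : ℝ} (hx : 0 ≤ x) (hy : 0 ≤ y)
    (h1 : K ≤ x + √2 * y) (h2 : K ≤ √2 * x + y) :
    let P := (B.map fanMatrix).prod
    (1 + √2) ^ B.length * K ≤ (x * P 0 0 + y * P 1 0) + √2 * (x * P 0 1 + y * P 1 1) ∧
    (1 + √2) ^ B.length * K ≤ √2 * (x * P 0 0 + y * P 1 0) + (x * P 0 1 + y * P 1 1) := by
  induction B generalizing K x y with
  | nil => simpa using ⟨h1, h2⟩
  | cons β B ih =>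
    have hs : √2 * √2 = 2 := Real.mul_self_sqrt (by norm_num)
    have hs1 : 1 ≤ √2 := Real.one_le_sqrt.2 (by norm_num)
    obtain ⟨b, m⟩ := β
    have hm : (0 : ℝ) ≤ m := m.cast_nonneg
    have hmx : 0 ≤ m * x := mul_nonneg hm hx
    have hmy : 0 ≤ m * y := mul_nonneg hm hy
    have hsmx : 0 ≤ √2 * (m * x) := mul_nonneg (by linarith) hmx
    have hsmy : 0 ≤ √2 * (m * y) := mul_nonneg (by linarith) hmy
    have hsx : x ≤ √2 * x := le_mul_of_one_le_left hx hs1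
    have hsy : y ≤ √2 * y := le_mul_of_one_le_left hy hs1
    have h1' := mul_le_mul_of_nonneg_left h1 (show 0 ≤ 1 + √2 by linarith)
    have h2' := mul_le_mul_of_nonneg_left h2 (show 0 ≤ 1 + √2 by linarith)
    have e1 : (1 + √2) * (x + √2 * y) = x + √2 * x + √2 * y + 2 * y := by
      linear_combination y * hs
    have e2 : (1 + √2) * (√2 * x + y) = √2 * x + 2 * x + y + √2 * y := by
      linear_combination x * hs
    rw [e1] at h1'
    rw [e2] at h2'
    intro P
    have hP (j : Fin 2) : P 0 j = fanMatrix (b, m) 0 0 * (B.map fanMatrix).prod 0 j +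
        fanMatrix (b, m) 0 1 * (B.map fanMatrix).prod 1 j ∧
        P 1 j = fanMatrix (b, m) 1 0 * (B.map fanMatrix).prod 0 j +
        fanMatrix (b, m) 1 1 * (B.map fanMatrix).prod 1 j := by
      simp only [P, List.map_cons, List.prod_cons, Matrix.SpecialLinearGroup.coe_mul, mul_apply,
        Fin.sum_univ_two, and_self]
    rw [(hP 0).1, (hP 1).1, (hP 0).2, (hP 1).2, List.length_cons, pow_succ, mul_assoc]
    cases b
    · have := ih (K := (1 + √2) * K) (x := x + (m + 1) * y) (y := x + (m + 2) * y)
        (by linarith) (by linarith) (by linarith) (by linarith)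
      simp only [fanMatrix, of_apply, cons_val_zero, cons_val_one, cons_val', cons_val_fin_one]
      push_cast
      constructor
      · refine this.1.trans_eq ?_
        ring
      · refine this.2.trans_eq ?_
        ring
    · have := ih (K := (1 + √2) * K) (x := (m + 2) * x + y) (y := (m + 1) * x + y)
        (by linarith) (by linarith) (by linarith) (by linarith)
      simp only [fanMatrix, of_apply, cons_val_zero, cons_val_one, cons_val', cons_val_fin_one]
      push_cast
      constructor
      · refine this.1.trans_eq ?_
        ring
      · refine this.2.trans_eq ?_
        ring

theorem trace_pow_silver (l : ℕ) :
    (((!![2, 1; 1, 0] : Matrix (Fin 2) (Fin 2) ℤ) ^ l).trace : ℝ) =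
      (1 + √2) ^ l + (1 - √2) ^ l := by
  have hs : √2 ^ 2 = 2 := Real.sq_sqrt (by norm_num)
  induction l using Nat.twoStepInduction with
  | zero => simp; norm_num
  | one => simp [trace_fin_two]; norm_num
  | more l h1 h2 =>
    have e : (!![2, 1; 1, 0] : Matrix (Fin 2) (Fin 2) ℤ) ^ 2 = (2 : ℤ) • !![2, 1; 1, 0] + 1 := by
      ext i j
      fin_cases i <;> fin_cases j <;> simp [pow_two]
    rw [pow_add, e, mul_add, mul_one, mul_smul_comm, ← pow_succ, trace_add, trace_smul]
    push_cast [smul_eq_mul]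
    rw [h1, h2]
    linear_combination (-(1 + √2) ^ l - (1 - √2) ^ l) * hs

theorem trace_pow_silver_le_trace_prod_fans (B : List (Bool × ℕ)) (hB : B ≠ []) :
    ((!![2, 1; 1, 0] : Matrix (Fin 2) (Fin 2) ℤ) ^ B.length).trace ≤
      ((B.map fanMatrix).prod : Matrix (Fin 2) (Fin 2) ℤ).trace := by
  have hpos := prod_fans_pos B hB
  have hbd := fun K x y h1 h2 h3 h4 => pow_mul_le_prod_fans B (K := K) (x := x) (y := y) h1 h2 h3 h4
  set P := (B.map fanMatrix).prod
  have hd := P.det_coe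
  rw [det_fin_two] at hd
  rw [trace_fin_two (P : Matrix (Fin 2) (Fin 2) ℤ)]
  have hdR : (P 0 0 : ℝ) * P 1 1 - P 0 1 * P 1 0 = 1 := by exact_mod_cast hd
  have ha : (0 : ℝ) < P 0 0 := by exact_mod_cast hpos 0 0
  have hb : (0 : ℝ) < P 0 1 := by exact_mod_cast hpos 0 1
  have hc : (0 : ℝ) < P 1 0 := by exact_mod_cast hpos 1 0
  have hd' : (0 : ℝ) < P 1 1 := by exact_mod_cast hpos 1 1
  set a : ℝ := ((P 0 0 : ℤ) : ℝ)
  set b : ℝ := ((P 0 1 : ℤ) : ℝ)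
  set c : ℝ := ((P 1 0 : ℤ) : ℝ)
  set d : ℝ := ((P 1 1 : ℤ) : ℝ)
  have hbc : 0 < b * c := mul_pos hb hc
  set r := √((a - d) ^ 2 + 4 * (b * c)) with hr
  have hr2 : r ^ 2 = (a - d) ^ 2 + 4 * (b * c) := Real.sq_sqrt (by positivity)
  have hrlt : |a - d| < r := by
    refine abs_lt_of_sq_lt_sq ?_ (Real.sqrt_nonneg _)
    linarith
  -- The leading eigenvalue of `P`; `(c, lam - a)` is a left eigenvector, positive since `|a - d| <
  -- r`.
  set lam := (a + d + r) / 2 with hlam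
  have hroot : lam ^ 2 = (a + d) * lam - 1 := by
    rw [hlam]; linear_combination hr2 / 4 - hdR
  have hy : 0 < lam - a := by
    have := (abs_lt.1 hrlt).2
    rw [hlam]; linarith
  have hl0 : 0 < lam := by linarith
  have hs0 : 0 < √2 := by positivity
  set K := min (c + √2 * (lam - a)) (√2 * c + (lam - a)) with hK
  have hK0 : 0 < K := lt_min (by positivity) (by positivity)
  obtain ⟨h1, h2⟩ := hbd K c (lam - a) hc.le hy.le (min_le_left _ _) (min_le_right _ _)
  have e1 : c * a + (lam - a) * c = lam * c := by ring
  have e2 : c * b + (lam - a) * d = lam * (lam - a) := by linear_combination -hroot - hdR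
  rw [e1, e2] at h1 h2
  have h3 : (1 + √2) ^ B.length * K ≤ lam * K := by
    rw [hK, mul_min_of_nonneg _ _ hl0.le, ← hK]
    exact le_min (h1.trans_eq (by ring)) (h2.trans_eq (by ring))
  have h4 : (1 + √2) ^ B.length ≤ lam := le_of_mul_le_mul_right h3 hK0
  set nu := (1 + √2) ^ B.length with hnu
  have hnu1 : 1 ≤ nu := one_le_pow₀ (by linarith)
  have hnu0 : 0 < nu := by linarith
  -- The conjugate `1 - √2` has absolute value `(1 + √2)⁻¹`, and its powers may be negative, so only
  -- an inequality holds.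
  have h5 : (1 - √2) ^ B.length ≤ nu⁻¹ := by
    refine (le_abs_self _).trans_eq ?_
    rw [abs_pow, hnu, ← inv_pow]
    congr 1
    rw [abs_of_nonpos (by linarith [Real.one_le_sqrt.2 (one_le_two (α := ℝ))])]
    refine eq_inv_of_mul_eq_one_left ?_
    linear_combination Real.mul_self_sqrt (zero_le_two (α := ℝ))
  have h6 : nu + nu⁻¹ ≤ a + d := by
    have h7 : a + d = lam + lam⁻¹ := by
      field_simp
      linear_combination -hroot
    have h8 : lam + lam⁻¹ - (nu + nu⁻¹) = (lam - nu) * (1 - (lam * nu)⁻¹) := by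
      field_simp
      ring
    have h9 : (lam * nu)⁻¹ ≤ 1 := inv_le_one_of_one_le₀ (by nlinarith)
    nlinarith [mul_nonneg (sub_nonneg.2 h4) (sub_nonneg.2 h9)]
  have h10 : (((!![2, 1; 1, 0] : Matrix (Fin 2) (Fin 2) ℤ) ^ B.length).trace : ℝ) ≤
      ((P 0 0 + P 1 1 : ℤ) : ℝ) := by
    rw [trace_pow_silver]
    push_cast
    linarith
  exact_mod_cast h10

theorem trace_conj (g C : SpecialLinearGroup (Fin 2) ℤ) :
    ((g * C * g⁻¹ : SpecialLinearGroup (Fin 2) ℤ) : Matrix (Fin 2) (Fin 2) ℤ).trace =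
      (C : Matrix (Fin 2) (Fin 2) ℤ).trace := by
  rw [Matrix.SpecialLinearGroup.coe_mul, trace_mul_comm, ← Matrix.SpecialLinearGroup.coe_mul,
    _root_.inv_mul_cancel_left]

theorem exists_axis_of_two_lt_trace (A : SpecialLinearGroup (Fin 2) ℤ)
    (hA : 2 < (A : Matrix (Fin 2) (Fin 2) ℤ).trace) :
    ∃ l P, IsGeodesicAxis A P l ∧ ((!![2, 1; 1, 0] : Matrix (Fin 2) (Fin 2) ℤ) ^ l).trace ≤
      (A : Matrix (Fin 2) (Fin 2) ℤ).trace := by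
  obtain ⟨g, C, rfl, hC⟩ := exists_conj_pos A hA
  obtain ⟨h, B, rfl⟩ := exists_conj_fans_of_pos C hC
  rw [trace_conj, trace_conj] at *
  have hB : B ≠ [] := by
    rintro rfl
    simp at hA
  obtain ⟨P, hP⟩ := exists_isGeodesicAxis_prod_fans B hB
  exact ⟨_, _, (hP.conj h).conj g, trace_pow_silver_le_trace_prod_fans B hB⟩

theorem IsAnosov.exists_hasTranslationLength {A : SpecialLinearGroup (Fin 2) ℤ}
    (hA : IsAnosov A) :
    ∃ l : ℕ, HasTranslationLength A l ∧
      ((!![2, 1; 1, 0] : Matrix (Fin 2) (Fin 2) ℤ) ^ l).trace ≤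
        |(A : Matrix (Fin 2) (Fin 2) ℤ).trace| := by
  rcases lt_abs.1 hA with h | h
  · obtain ⟨l, P, hP, hl⟩ := exists_axis_of_two_lt_trace A h
    exact ⟨l, hP.hasTranslationLength, hl.trans (le_abs_self _)⟩
  · have e : ((-A : SpecialLinearGroup (Fin 2) ℤ) : Matrix (Fin 2) (Fin 2) ℤ).trace =
        -(A : Matrix (Fin 2) (Fin 2) ℤ).trace := by
      rw [Matrix.SpecialLinearGroup.coe_neg, trace_neg]
    obtain ⟨l, P, hP, hl⟩ := exists_axis_of_two_lt_trace (-A) (by rwa [e])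
    refine ⟨l, ?_, hl.trans (by rw [e]; exact neg_le_abs _)⟩
    simpa using hP.neg.hasTranslationLength

end Trace

/-! ### Continued fraction matrices as products of elementary ones. -/

section ContinuedFraction

open Matrix

/-- The product of the elementary continued fraction matrices with partial quotients `a`. -/
def continuantMatrix (a : List ℕ) : Matrix (Fin 2) (Fin 2) ℤ :=
  (a.map fun k => !![(k : ℤ), 1; 1, 0]).prod

theorem continuantMatrix_cons (k : ℕ) (a : List ℕ) :
    continuantMatrix (k :: a) = !![(k : ℤ), 1; 1, 0] * continuantMatrix a := by
  simp [continuantMatrix]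

theorem det_continuantMatrix (a : List ℕ) : (continuantMatrix a).det = (-1) ^ a.length := by
  induction a with
  | nil => simp [continuantMatrix]
  | cons k a ih => rw [continuantMatrix_cons, det_mul, ih, List.length_cons, pow_succ']; simp

theorem continuantMatrix_col_zero (a : List ℕ) (ha : a ≠ []) (hpos : ∀ k ∈ a, 0 < k) :
    0 < continuantMatrix a 0 0 ∧ 0 < continuantMatrix a 1 0 ∧
      contFracValue a = (continuantMatrix a 0 0 : ℚ) / continuantMatrix a 1 0 := by
  induction a with
  | nil => exact absurd rfl ha
  | cons k a ih =>
    have hk : 0 < k := hpos k (by simp)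
    rcases a with _ | ⟨b, t⟩
    · simpa [continuantMatrix, contFracValue] using hk
    · obtain ⟨h0, h1, h2⟩ := ih (by simp) fun j hj => hpos j (List.mem_cons_of_mem _ hj)
      rw [continuantMatrix_cons, contFracValue, h2]
      have h0' : (0 : ℚ) < continuantMatrix (b :: t) 0 0 := by exact_mod_cast h0
      have h1' : (0 : ℚ) < continuantMatrix (b :: t) 1 0 := by exact_mod_cast h1
      simp only [mul_apply, Fin.sum_univ_two, of_apply, cons_val', cons_val_zero, cons_val_one,
        cons_val_fin_one]
      refine ⟨by positivity, by simpa using h0, ?_⟩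
      push_cast
      field_simp
      ring

/-- Determinant `±1` makes the first column coprime, so the quotient is already in lowest terms. -/
theorem num_den_contFracValue (a : List ℕ) (ha : a ≠ []) (hpos : ∀ k ∈ a, 0 < k) :
    (contFracValue a).num = continuantMatrix a 0 0 ∧
      ((contFracValue a).den : ℤ) = continuantMatrix a 1 0 := by
  obtain ⟨-, h1, h2⟩ := continuantMatrix_col_zero a ha hpos
  have hdet := det_continuantMatrix a
  rw [det_fin_two] at hdet
  have hsq : ((-1 : ℤ) ^ a.length) * (-1) ^ a.length = 1 := by
    rw [← mul_pow]; simp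
  have hc : IsCoprime (continuantMatrix a 0 0) (continuantMatrix a 1 0) :=
    ⟨(-1) ^ a.length * continuantMatrix a 1 1, -(-1) ^ a.length * continuantMatrix a 0 1, by
      linear_combination (-1) ^ a.length * hdet + hsq⟩
  have hc' : (continuantMatrix a 0 0).natAbs.Coprime (continuantMatrix a 1 0).natAbs := by
    simpa [Int.isCoprime_iff_gcd_eq_one, Int.gcd] using hc
  rw [h2, Rat.num_div_eq_of_coprime h1 hc', Rat.den_div_eq_of_coprime h1 hc']
  exact ⟨rfl, rfl⟩

theorem continuantMatrix_col_one (a : List ℕ) (ha : a ≠ []) (i : Fin 2) :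
    continuantMatrix a i 1 = continuantMatrix a.dropLast i 0 := by
  conv_lhs => rw [← List.dropLast_append_getLast ha]
  simp [continuantMatrix, mul_apply]

theorem contFracMatrix_eq_continuantMatrix (a : List ℕ) (hpos : ∀ k ∈ a, 0 < k) :
    contFracMatrix a = continuantMatrix a := by
  match a with
  | [] => rfl
  | [a] => simp [contFracMatrix, continuantMatrix]
  | a :: b :: t =>
    obtain ⟨h1, h2⟩ := num_den_contFracValue (a :: b :: t) (by simp) hpos
    obtain ⟨h3, h4⟩ := num_den_contFracValue (a :: b :: t).dropLast (by simp)
      fun k hk => hpos k (List.mem_of_mem_dropLast hk)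
    rw [contFracMatrix, h1, h2, h3, h4, ← continuantMatrix_col_one _ (by simp),
      ← continuantMatrix_col_one _ (by simp)]
    exact (eta_fin_two _).symm

/-- All entries are positive and the determinant is `1`, so the diagonal product is at least `2` and
the squared trace at least `8`. Even length also rules out a single quotient, whose matrix has a
zero entry. -/
theorem two_lt_trace_continuantMatrix (a : List ℕ) (ha : a ≠ []) (he : Even a.length)
    (hpos : ∀ k ∈ a, 0 < k) : 2 < (continuantMatrix a).trace := by
  obtain ⟨h1, h2, -⟩ := continuantMatrix_col_zero a ha hpos
  have hdl : a.dropLast ≠ [] := by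
    match a with
    | [] => exact absurd rfl ha
    | [_] => simp at he
    | _ :: _ :: _ => simp
  obtain ⟨h3, h4, -⟩ := continuantMatrix_col_zero a.dropLast hdl
    fun k hk => hpos k (List.mem_of_mem_dropLast hk)
  rw [← continuantMatrix_col_one a ha] at h3 h4
  have hdet := det_continuantMatrix a
  rw [det_fin_two, he.neg_one_pow] at hdet
  rw [trace_fin_two]
  have := mul_pos h3 h2
  nlinarith [sq_nonneg (continuantMatrix a 0 0 - continuantMatrix a 1 1)]

end ContinuedFraction

/-! ### The main theorem. -/

theorem corollary5 :
    (∀ A : Matrix.SpecialLinearGroup (Fin 2) ℤ, IsAnosov A →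
      ∃ l : ℕ, HasTranslationLength A l ∧
        ((!![2, 1; 1, 0] : Matrix (Fin 2) (Fin 2) ℤ) ^ l).trace ≤
          |(A : Matrix (Fin 2) (Fin 2) ℤ).trace|) ∧
    (∀ a : List ℕ, a ≠ [] → Even a.length → (∀ k ∈ a, 0 < k) →
      ∃ A : Matrix.SpecialLinearGroup (Fin 2) ℤ,
        (A : Matrix (Fin 2) (Fin 2) ℤ) = contFracMatrix a ∧
        ∃ l : ℕ, HasTranslationLength A l ∧
          ((!![2, 1; 1, 0] : Matrix (Fin 2) (Fin 2) ℤ) ^ l).trace ≤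
            (contFracMatrix a).trace) := by
  refine ⟨fun A hA => hA.exists_hasTranslationLength, fun a ha he hpos => ?_⟩
  rw [contFracMatrix_eq_continuantMatrix a hpos]
  have htr := two_lt_trace_continuantMatrix a ha he hpos
  refine ⟨⟨continuantMatrix a, by rw [det_continuantMatrix, he.neg_one_pow]⟩, rfl, ?_⟩
  obtain ⟨l, P, hP, hl⟩ := exists_axis_of_two_lt_trace ⟨continuantMatrix a, _⟩ htr
  exact ⟨l, hP.hasTranslationLength, hl⟩
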